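/- Let $k \ge 3$ and let $G$ be a finite, simple, connected, $k$-regular graph embedded in the plane. The degree of a face is the number of edges on its boundary, where an edge that has the face on both of its sides counts twice. Then it is impossible that one face $F$ of $G$ has degree $d_1$ and all faces other than $F$ have a common degree $d_2 \neq d_1$. -/

import Mathlib

/-- A drawing of a connected graph `G` on a closed oriented surface, in combinatorial form: at each
vertex, the cyclic order in which the edges leave it. An edge leaving `v` is a dart with tail `v`;
`rot` sends it to the next dart around `v`, and the darts at `v` form a single cycle of `rot`. -/
structure RotationSystem {V : Type*} (G : SimpleGraph V) where
  rot : Equiv.Perm G.Dart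
  rot_fst : ∀ d : G.Dart, (rot d).fst = d.fst
  sameCycle_of_fst_eq : ∀ d d' : G.Dart, d.fst = d'.fst → rot.SameCycle d d'

namespace RotationSystem

variable {V : Type*} {G : SimpleGraph V}

/-- Reversal of darts. -/
def flip (G : SimpleGraph V) : Equiv.Perm G.Dart :=
  Function.Involutive.toPerm SimpleGraph.Dart.symm SimpleGraph.Dart.symm_involutive

/-- Face tracing: go along the dart `d` to its head, and leave by the edge that follows there. -/
def facePerm (M : RotationSystem G) : Equiv.Perm G.Dart :=
  (flip G).trans M.rot

/-- The faces are the cycles of the face tracing permutation (closed facial walks). -/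
def Face (M : RotationSystem G) : Type _ :=
  Quotient (Equiv.Perm.SameCycle.setoid M.facePerm)

/-- The face that lies beside the dart `d`. The two sides of the edge of `d` are the faces
`M.face d` and `M.face d.symm` (which may coincide). -/
def face (M : RotationSystem G) (d : G.Dart) : M.Face :=
  Quotient.mk (Equiv.Perm.SameCycle.setoid M.facePerm) d

/-- The degree of a face: the length of its facial walk, so that an edge with the face on both
sides counts twice. -/
noncomputable def faceDegree (M : RotationSystem G) (F : M.Face) : ℕ :=
  Nat.card {d : G.Dart // M.face d = F}

/-- `S` is one of the two sides of the cycle `c`: the edges with exactly one of their two sides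
in the set of faces `S` are exactly the edges of `c`. -/
def IsSideOf (M : RotationSystem G) (S : Set M.Face) {v : V} (c : G.Walk v v) : Prop :=
  ∀ d : G.Dart, d.edge ∈ c.edges ↔ Xor (M.face d ∈ S) (M.face d.symm ∈ S)

/-- The drawing of the connected graph `G` is planar (it is a drawing on the sphere, or in the
plane with one face unbounded): every cycle of `G` separates the faces into an inside and an
outside. -/
def IsPlanar (M : RotationSystem G) : Prop :=
  ∀ (v : V) (c : G.Walk v v), c.IsCycle → ∃ S : Set M.Face, M.IsSideOf S c

end RotationSystem

/-! Euler's formula forces `k * d₂ < 2 * d₂ + 2 * k`, so `(k, d₂)` is the type of a Platonic solid,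
and the drawing can be developed onto that solid. In a group `H` generated by a vertex rotation `r`
and an edge half-turn `s`, darts get labels so that `rot` acts as `r` and reversal as `s`. Such
labels exist along a spanning tree. They extend across the other edges, from the leaves of the dual
tree toward `F`, because every face but `F` closes up by `(r * s) ^ d₂ = 1`
(`IsPlanar.exists_labelling`).

Every label is then used equally often, say `n` times. The walk around `F` closes up too, so `d₁ = m
* d₂`, and it repeats a label `m` times, so `m ≤ n`. Euler's formula and the order of `H` give `2 *
n ≤ m + 1`. Hence `m ≤ 1`, and `d₁` is `0` or `d₂`. -/

/-! ### Trees: flows, fundamental cycles, potentials. -/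

namespace SimpleGraph

variable {V : Type*} {G T : SimpleGraph V}

/-- A flow modulo 2 whose support lies in an acyclic graph vanishes. -/
theorem IsAcyclic.eq_zero_of_flow [Fintype V] [DecidableEq V] [DecidableRel G.Adj]
    (hT : T.IsAcyclic) (c : G.Dart → ZMod 2) (hsymm : ∀ d, c d.symm = c d)
    (hsupp : ∀ d : G.Dart, ¬ T.Adj d.fst d.snd → c d = 0)
    (hflow : ∀ v, ∑ d with d.fst = v, c d = 0) (e : G.Dart) : c e = 0 := by
  classical
  by_cases he : T.Adj e.fst e.snd
  swap
  · exact hsupp e he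
  have hbr := (isBridge_iff (G := T)).mp (isAcyclic_iff_forall_adj_isBridge.mp hT he)
  set T' := T.deleteEdges {s(e.fst, e.snd)} with hT'
  -- Total flow out of the component of `e.fst` in `T` minus `e`: inner darts cancel in pairs, and
  -- only `e` leaves.
  have htot : ∑ d : G.Dart with T'.Reachable e.fst d.fst, c d = 0 := by
    rw [← Finset.sum_fiberwise_of_maps_to (g := fun d : G.Dart => d.fst)
      (t := Finset.univ.filter fun v => T'.Reachable e.fst v) (by simp)]
    refine Finset.sum_eq_zero fun v hv => ?_
    rw [Finset.filter_filter, ← hflow v]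
    congr 1
    ext d
    simp only [Finset.mem_filter, Finset.mem_univ, true_and] at hv ⊢
    exact ⟨fun h => h.2, fun h => ⟨h ▸ hv, h⟩⟩
  rw [← Finset.sum_filter_add_sum_filter_not _ (fun d : G.Dart => T'.Reachable e.fst d.snd)] at htot
  rw [Finset.filter_filter, Finset.filter_filter] at htot
  have hin : ∑ d : G.Dart with T'.Reachable e.fst d.fst ∧ T'.Reachable e.fst d.snd, c d = 0 := by
    refine Finset.sum_involution (fun d _ => d.symm) (fun d _ => ?_) (fun d _ _ => d.symm_ne)
      (fun d hd => ?_) (fun d _ => d.symm_symm)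
    · rw [hsymm]; exact CharTwo.add_self_eq_zero _
    · simp only [Finset.mem_filter, Finset.mem_univ, true_and] at hd ⊢
      exact ⟨hd.2, hd.1⟩
  rw [hin, zero_add, Finset.sum_eq_single e] at htot
  · exact htot
  · intro d hd hne
    simp only [Finset.mem_filter, Finset.mem_univ, true_and] at hd
    by_contra hc
    have hadj : T.Adj d.fst d.snd := by
      by_contra h
      exact hc (hsupp d h)
    refine hd.2 (hd.1.trans (Adj.reachable ?_))
    rw [hT', deleteEdges_adj]
    refine ⟨hadj, fun h => ?_⟩
    have h' : d.edge = e.edge := h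
    rcases (dart_edge_eq_iff d e).mp h' with h1 | h1
    · exact hne h1
    · subst h1
      exact hbr hd.1
  · intro h
    exact absurd (Finset.mem_filter.mpr ⟨Finset.mem_univ _, Reachable.refl _, hbr⟩) h

/-- The endpoints of an edge outside a spanning tree lie on a cycle whose other edges are in the
tree. -/
theorem IsTree.exists_isCycle_of_not_adj (hT : T.IsTree) (hTG : T ≤ G) (e : G.Dart)
    (he : ¬ T.Adj e.fst e.snd) : ∃ c : G.Walk e.fst e.fst, c.IsCycle ∧
      ∀ d : G.Dart, ¬ T.Adj d.fst d.snd → (d.edge ∈ c.edges ↔ d.edge = e.edge) := by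
  obtain ⟨p, hp, -⟩ := hT.existsUnique_path e.snd e.fst
  have key : ∀ d : G.Dart, ¬ T.Adj d.fst d.snd → d.edge ∉ (p.mapLe hTG).edges := by
    intro d hd h
    rw [Walk.edges_mapLe_eq_edges] at h
    exact hd (p.edges_subset_edgeSet h)
  refine ⟨Walk.cons e.adj (p.mapLe hTG), ?_, fun d hd => ?_⟩
  · rw [Walk.cons_isCycle_iff]
    exact ⟨hp.mapLe hTG, key e he⟩
  · rw [Walk.edges_cons, List.mem_cons]
    exact or_iff_left (key d hd)

/-- The product of the labels of the edges along a walk. -/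
def Walk.holonomy {H : Type*} [Group H] (t : V → V → H) : ∀ {u v : V}, T.Walk u v → H
  | _, _, .nil => 1
  | u, _, .cons (v := v) _ p => t v u * p.holonomy t

/-- On a tree, antisymmetric labels of the edges in a group have a potential. -/
theorem IsTree.exists_potential {H : Type*} [Group H] (hT : T.IsTree) (t : V → V → H)
    (ht : ∀ u v, t v u = (t u v)⁻¹) : ∃ h : V → H, ∀ u v, T.Adj u v → h v = t u v * h u := by
  classical
  obtain ⟨v₀⟩ := hT.connected.nonempty
  choose P hP hPu using fun v => hT.existsUnique_path v v₀
  refine ⟨fun v => (P v).holonomy t, ?_⟩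
  -- If `u` is nearer the root, the path from `v` is the edge to `u` followed by the path from `u`.
  have key : ∀ u v, T.Adj u v → v ∉ (P u).support →
      (P v).holonomy t = t u v * (P u).holonomy t := by
    intro u v huv hv
    rw [← hPu v (Walk.cons huv.symm (P u)) ((hP u).cons hv)]
    rfl
  intro u v huv
  by_cases hv : v ∈ (P u).support
  · have hu : u ∉ (P v).support := by
      intro hu
      exact hT.isAcyclic.ne_mem_support_of_support_of_adj_of_isPath (hP u).reverse (hP v).reverse
        huv (by simpa using hv) (by simpa using hu)
    change (P v).holonomy t = t u v * (P u).holonomy t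
    rw [key v u huv.symm hu, ht u v]
    group
  · exact key u v huv hv

end SimpleGraph

/-! ### Rotation groups of the Platonic solids. -/

open Equiv in
/-- There is a finite group generated by a rotation `r` of order `k` and an involution `s` with
`r * s` of order `d`, at least as large as the rotation group of the Platonic solid with vertices
of degree `k` and faces of degree `d`. -/
def HasRotationGroup (k d : ℕ) : Prop :=
  ∃ (H : Type) (_ : Group H) (_ : Finite H) (r s : H), orderOf r = k ∧ s * s = 1 ∧
    orderOf (r * s) = d ∧ Subgroup.closure {r, s} = ⊤ ∧
    -- That is, `|H| ≥ 4kd / (2d + 2k - kd)`, the number of darts of the solid, without subtraction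
    -- or division.
    4 * k * d + Nat.card H * (k * d) ≤ Nat.card H * (2 * d + 2 * k)

namespace HasRotationGroup

/-- Since `(r * s) * s = r`, the generators `r * s` and `s` exchange the two orders. -/
theorem dual {k d : ℕ} (h : HasRotationGroup k d) : HasRotationGroup d k := by
  obtain ⟨H, _, _, r, s, hr, hs, hrs, hcl, hcard⟩ := h
  refine ⟨H, _, ‹_›, r * s, s, hrs, hs, by rw [mul_assoc, hs, mul_one, hr], ?_, by linarith⟩
  rw [eq_top_iff, ← hcl, Subgroup.closure_le]
  have h1 : r * s ∈ Subgroup.closure {r * s, s} := Subgroup.subset_closure (by simp)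
  have h2 : s ∈ Subgroup.closure {r * s, s} := Subgroup.subset_closure (by simp)
  rintro x (rfl | rfl)
  · have := mul_mem h1 h2
    rwa [mul_assoc, hs, mul_one] at this
  · exact h2

theorem of_subgroup {k d : ℕ} {G : Type} [Group G] [Finite G] {r s : G} (hr : orderOf r = k)
    (hs : s * s = 1) (hrs : orderOf (r * s) = d)
    (hcard : 4 * k * d + Nat.card (Subgroup.closure {r, s}) * (k * d) ≤
      Nat.card (Subgroup.closure {r, s}) * (2 * d + 2 * k)) : HasRotationGroup k d := by
  have h1 : r ∈ Subgroup.closure {r, s} := Subgroup.subset_closure (by simp)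
  have h2 : s ∈ Subgroup.closure {r, s} := Subgroup.subset_closure (by simp)
  refine ⟨Subgroup.closure {r, s}, inferInstance, inferInstance, ⟨r, h1⟩, ⟨s, h2⟩, ?_,
    Subtype.ext hs, ?_, ?_, hcard⟩
  · rw [← hr, ← Subgroup.orderOf_coe]
  · rw [← hrs, ← Subgroup.orderOf_coe]; rfl
  · rw [← Subgroup.closure_closure_coe_preimage (k := {r, s})]
    congr 1
    ext x
    simp [Subtype.ext_iff]

open Equiv

theorem three_three : HasRotationGroup 3 3 := by
  refine of_subgroup (r := (c[0, 1, 2] : Perm (Fin 4))) (s := c[0, 1] * c[2, 3])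
    (orderOf_eq_prime (by decide) (by decide)) (by decide)
    (orderOf_eq_prime (by decide) (by decide)) ?_
  set r : Perm (Fin 4) := c[0, 1, 2]
  set s : Perm (Fin 4) := c[0, 1] * c[2, 3]
  have h1 : r ∈ Subgroup.closure {r, s} := Subgroup.subset_closure (by simp)
  have h2 : s ∈ Subgroup.closure {r, s} := Subgroup.subset_closure (by simp)
  have hle : alternatingGroup (Fin 4) ≤ Subgroup.closure {r, s} := by
    -- These are 3 + 9 words for the 12 even permutations.
    have hw : ∀ g : Perm (Fin 4), Perm.sign g = 1 →
        ∃ i j : Fin 3, g = r ^ i.val ∨ g = r ^ i.val * s * r ^ j.val := by decide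
    intro g hg
    obtain ⟨i, j, rfl | rfl⟩ := hw g hg
    · exact pow_mem h1 _
    · exact mul_mem (mul_mem (pow_mem h1 _) h2) (pow_mem h1 _)
  have := Subgroup.card_le_of_le hle
  rw [nat_card_alternatingGroup, Nat.card_fin] at this
  norm_num [Nat.factorial] at this
  linarith

theorem four_three : HasRotationGroup 4 3 := by
  refine of_subgroup (r := finRotate 4) (s := swap 0 1) ?_ (by decide)
    (orderOf_eq_prime (by decide) (by decide)) ?_
  · exact orderOf_eq_prime_pow (p := 2) (n := 1) (by decide) (by decide)
  · have := Perm.closure_cycle_adjacent_swap (isCycle_finRotate (n := 2)) support_finRotate 0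
    rw [show finRotate (2 + 2) 0 = (1 : Fin 4) by decide] at this
    rw [this, Subgroup.card_top, Nat.card_perm, Nat.card_fin]
    decide

set_option maxRecDepth 2000 in
-- The generated group is transitive of prime degree, hence primitive; as it contains a 3-cycle,
-- Jordan's theorem puts the alternating group inside it.
theorem three_five : HasRotationGroup 3 5 := by
  have : Fact (Nat.Prime 5) := ⟨Nat.prime_five⟩
  refine of_subgroup (r := (c[0, 1, 2] : Perm (Fin 5))) (s := c[0, 3] * c[1, 4])
    (orderOf_eq_prime (by decide) (by decide)) (by decide)
    (orderOf_eq_prime (by decide) (by decide)) ?_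
  set r : Perm (Fin 5) := c[0, 1, 2]
  set s : Perm (Fin 5) := c[0, 3] * c[1, 4]
  have h1 : r ∈ Subgroup.closure {r, s} := Subgroup.subset_closure (by simp)
  have h2 : s ∈ Subgroup.closure {r, s} := Subgroup.subset_closure (by simp)
  have hrot : ∀ x : Fin 5, ∃ i : Fin 5, ((r * s) ^ i.val) 0 = x := by decide
  have : MulAction.IsPretransitive (Subgroup.closure {r, s}) (Fin 5) := by
    refine MulAction.IsPretransitive.of_orbit (x₀ := (0 : Fin 5)) fun x => ?_
    obtain ⟨i, hi⟩ := hrot x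
    exact ⟨⟨(r * s) ^ i.val, pow_mem (mul_mem h1 h2) _⟩, hi⟩
  have hprim : MulAction.IsPreprimitive (Subgroup.closure {r, s}) (Fin 5) :=
    MulAction.IsPreprimitive.of_prime_card (by simpa using Nat.prime_five)
  have hle := Perm.alternatingGroup_le_of_isPreprimitive_of_isThreeCycle_mem hprim
    (card_support_eq_three_iff.mp (by decide)) h1
  have := Subgroup.card_le_of_le hle
  rw [nat_card_alternatingGroup, Nat.card_fin] at this
  norm_num [Nat.factorial] at this
  linarith

/-- The five Platonic types. -/
theorem of_spherical {k d : ℕ} (hk : 3 ≤ k) (hd : 3 ≤ d) (h : k * d < 2 * d + 2 * k) :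
    HasRotationGroup k d := by
  have hk' : k < 6 := by nlinarith
  have hd' : d < 6 := by nlinarith
  interval_cases k <;> interval_cases d <;> try omega
  · exact three_three
  · exact four_three.dual
  · exact three_five
  · exact four_three
  · exact three_five.dual

end HasRotationGroup

/-! ### Faces, cuts and Euler's formula. -/

theorem Equiv.Perm.card_sameCycle {α : Type*} [Finite α] (f : Equiv.Perm α) (a : α) :
    Nat.card {x // f.SameCycle a x} = Function.minimalPeriod f a := by
  have : Fintype α := Fintype.ofFinite α
  classical
  have : Finite (MulAction.orbit (Subgroup.zpowers f) a) := inferInstance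
  have := Fintype.ofFinite (MulAction.orbit (Subgroup.zpowers f) a)
  have h := MulAction.minimalPeriod_eq_card (a := f) (b := a)
  rw [← Nat.card_eq_fintype_card] at h
  refine Eq.trans (Nat.card_congr (Equiv.subtypeEquivRight fun x => ?_)) h.symm
  constructor
  · rintro ⟨i, rfl⟩
    exact ⟨⟨f ^ i, i, rfl⟩, rfl⟩
  · rintro ⟨⟨_, i, rfl⟩, rfl⟩
    exact ⟨i, rfl⟩

namespace RotationSystem

open SimpleGraph

variable {V : Type*} {G T : SimpleGraph V} (M : RotationSystem G)

theorem facePerm_apply (d : G.Dart) : M.facePerm d = M.rot d.symm := rfl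

theorem face_eq_iff {d d' : G.Dart} : M.face d = M.face d' ↔ M.facePerm.SameCycle d d' :=
  Quotient.eq (r := Equiv.Perm.SameCycle.setoid M.facePerm)

theorem exists_face_eq (A : M.Face) : ∃ d, M.face d = A := Quotient.exists_rep A

@[simp] theorem face_facePerm (d : G.Dart) : M.face (M.facePerm d) = M.face d := by
  rw [face_eq_iff, Equiv.Perm.sameCycle_apply_left]

theorem face_rot (d : G.Dart) : M.face (M.rot d) = M.face d.symm := by
  rw [← M.face_facePerm d.symm, facePerm_apply, Dart.symm_symm]

theorem face_iterate (d : G.Dart) (i : ℕ) : M.face (M.facePerm^[i] d) = M.face d := by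
  induction i with
  | zero => rfl
  | succ i ih => rw [Function.iterate_succ_apply', face_facePerm, ih]

theorem finite_dart [Finite V] : Finite G.Dart :=
  Finite.of_injective _ Dart.toProd_injective

theorem finite_face [Finite V] : Finite M.Face :=
  have : Finite G.Dart := finite_dart
  Quotient.finite _

theorem faceDegree_face [Finite V] (d : G.Dart) :
    M.faceDegree (M.face d) = Function.minimalPeriod M.facePerm d := by
  have : Finite G.Dart := finite_dart
  rw [← Equiv.Perm.card_sameCycle, faceDegree]
  exact Nat.card_congr (Equiv.subtypeEquivRight fun x => by rw [← face_eq_iff, eq_comm])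

theorem sameCycle_rot_iff {d d' : G.Dart} : M.rot.SameCycle d d' ↔ d.fst = d'.fst := by
  refine ⟨?_, M.sameCycle_of_fst_eq d d'⟩
  rintro ⟨i, rfl⟩
  have h : ∀ (i : ℤ) d, ((M.rot ^ i) d).fst = d.fst := by
    intro i
    induction i with
    | zero => simp
    | succ n ih => intro d; rw [zpow_add_one, Equiv.Perm.mul_apply, ih, M.rot_fst]
    | pred n ih =>
      intro d
      rw [zpow_sub_one, Equiv.Perm.mul_apply, ih, ← M.rot_fst]
      exact congrArg (fun x : G.Dart => x.fst) (M.rot.apply_symm_apply d)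
  exact (h i d).symm

theorem minimalPeriod_rot [Fintype V] [DecidableRel G.Adj] (d : G.Dart) :
    Function.minimalPeriod M.rot d = G.degree d.fst := by
  classical
  rw [← Equiv.Perm.card_sameCycle, ← G.dart_fst_fiber_card_eq_degree, ← Fintype.card_subtype,
    ← Nat.card_eq_fintype_card]
  exact Nat.card_congr (Equiv.subtypeEquivRight fun x => by rw [sameCycle_rot_iff, eq_comm])

/-- The faces are connected with each other through the edges outside an acyclic graph: a set of
faces separated from its complement by edges of the acyclic graph only is empty or everything. -/
theorem mem_iff_mem_of_isAcyclic [Fintype V] (hG : G.Connected) (hT : T.IsAcyclic)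
    (S : Set M.Face)
    (hS : ∀ d : G.Dart, ¬ T.Adj d.fst d.snd → (M.face d ∈ S ↔ M.face d.symm ∈ S))
    (A B : M.Face) : A ∈ S ↔ B ∈ S := by
  classical
  let χ : G.Dart → ZMod 2 := fun d => if M.face d ∈ S then 1 else 0
  have hχ : ∀ d d', χ d + χ d' = 0 ↔ (M.face d ∈ S ↔ M.face d' ∈ S) := by
    intro d d'
    simp only [χ]
    split_ifs with h1 h2 h2 <;> simp [h1, h2]
    exact CharTwo.add_self_eq_zero _
  have hflip : ∀ d, M.face d ∈ S ↔ M.face d.symm ∈ S := by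
    intro e
    rw [← hχ]
    -- The coboundary of the indicator of `S` is a flow: `rot` carries the left faces around a
    -- vertex to the right ones.
    refine hT.eq_zero_of_flow (fun d => χ d + χ d.symm) (fun d => ?_) (fun d hd => ?_)
      (fun v => ?_) e
    · rw [Dart.symm_symm, add_comm]
    · exact (hχ _ _).mpr (hS d hd)
    · rw [Finset.sum_add_distrib]
      have : ∑ d : G.Dart with d.fst = v, χ d.symm = ∑ d : G.Dart with d.fst = v, χ d := by
        refine Finset.sum_equiv M.rot (fun d => by simp [M.rot_fst]) (fun d _ => ?_)
        simp only [χ, M.face_rot]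
      rw [this]
      exact CharTwo.add_self_eq_zero _
  have hrot : ∀ d d' : G.Dart, d.fst = d'.fst → (M.face d ∈ S ↔ M.face d' ∈ S) := by
    intro d d' h
    have : Finite G.Dart := finite_dart
    obtain ⟨i, rfl⟩ := (M.sameCycle_of_fst_eq d d' h).exists_nat_pow_eq
    clear h
    induction i with
    | zero => rfl
    | succ i ih =>
      rw [pow_succ', Equiv.Perm.mul_apply, face_rot, ← hflip]
      exact ih
  have hwalk : ∀ (u w : V) (_ : G.Walk u w) (d d' : G.Dart), d.fst = u → d'.fst = w →
      (M.face d ∈ S ↔ M.face d' ∈ S) := by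
    intro u w p
    induction p with
    | nil => exact fun d d' h h' => hrot d d' (h.trans h'.symm)
    | @cons u v w huv p ih =>
      intro d d' h h'
      rw [hrot d ⟨(u, v), huv⟩ h, hflip]
      exact ih _ d' rfl h'
  obtain ⟨a, rfl⟩ := M.exists_face_eq A
  obtain ⟨b, rfl⟩ := M.exists_face_eq B
  obtain ⟨p⟩ := hG.preconnected a.fst b.fst
  exact hwalk _ _ p a b rfl rfl

/-- In a planar drawing, every edge outside a spanning tree is the only such edge between some set
of faces and its complement. -/
theorem IsPlanar.exists_cut {M : RotationSystem G} (hM : M.IsPlanar) (hT : T.IsTree) (hTG : T ≤ G)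
    (e : G.Dart) (he : ¬ T.Adj e.fst e.snd) (F : M.Face) : ∃ S : Set M.Face, F ∉ S ∧
      ∀ d : G.Dart, ¬ T.Adj d.fst d.snd →
        (Xor (M.face d ∈ S) (M.face d.symm ∈ S) ↔ d.edge = e.edge) := by
  obtain ⟨c, hc, hce⟩ := hT.exists_isCycle_of_not_adj hTG e he
  obtain ⟨S, hS⟩ := hM _ c hc
  by_cases hF : F ∈ S
  · refine ⟨Sᶜ, by simpa using hF, fun d hd => ?_⟩
    rw [← hce d hd, hS d, Set.mem_compl_iff, Set.mem_compl_iff, xor_not_not]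
  · exact ⟨S, hF, fun d hd => by rw [← hce d hd, hS d]⟩

/-- Euler's formula. -/
theorem IsPlanar.card_face_add_card [Fintype V] [Fintype G.edgeSet] {M : RotationSystem G}
    (hM : M.IsPlanar) (hG : G.Connected) (hF : Nonempty M.Face) :
    Nat.card M.Face + Fintype.card V = G.edgeFinset.card + 2 := by
  classical
  obtain ⟨T, hTG, hT⟩ := hG.exists_isTree_le
  have : Fintype M.Face := have := M.finite_face; Fintype.ofFinite _
  let N := {x : Sym2 V // x ∈ G.edgeFinset \ T.edgeFinset}
  have hrep : ∀ x : N, ∃ d : G.Dart, d.edge = x.1 ∧ ¬ T.Adj d.fst d.snd := by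
    rintro ⟨x, hx⟩
    induction x with | _ u v
    simp only [Finset.mem_sdiff, mem_edgeFinset, mem_edgeSet] at hx
    exact ⟨⟨(u, v), hx.1⟩, rfl, hx.2⟩
  choose rep hrep hrepT using hrep
  -- Coboundary from faces to non-tree edges: its kernel is the constants, and the cuts make it
  -- surjective. Rank-nullity is Euler's formula.
  let δ : (M.Face → ZMod 2) →ₗ[ZMod 2] (N → ZMod 2) :=
    LinearMap.pi fun x => (LinearMap.proj (M.face (rep x)) : (M.Face → ZMod 2) →ₗ[ZMod 2] ZMod 2) +
      LinearMap.proj (M.face (rep x).symm)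
  have hδ : ∀ f x, δ f x = f (M.face (rep x)) + f (M.face (rep x).symm) := fun _ _ => rfl
  have hker : LinearMap.ker δ = Submodule.span (ZMod 2) {1} := by
    apply le_antisymm
    · intro f hf
      have key := M.mem_iff_mem_of_isAcyclic hG hT.isAcyclic {A | f A = 0} (fun d hd => by
        have hx : d.edge ∈ G.edgeFinset \ T.edgeFinset := by
          simp only [Finset.mem_sdiff, mem_edgeFinset]
          exact ⟨d.edge_mem, hd⟩
        have h0 := congrFun (LinearMap.mem_ker.mp hf) ⟨d.edge, hx⟩
        rw [hδ, Pi.zero_apply, CharTwo.add_eq_zero] at h0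
        rcases (dart_edge_eq_iff _ _).mp (hrep ⟨d.edge, hx⟩) with h | h
        · rw [h] at h0
          simp [h0]
        · rw [h, Dart.symm_symm] at h0
          simp [h0])
      obtain ⟨A⟩ := hF
      rw [Submodule.mem_span_singleton]
      refine ⟨f A, funext fun B => ?_⟩
      have := key A B
      simp only [Set.mem_ofPred_eq] at this
      simp only [Pi.smul_apply, Pi.one_apply, smul_eq_mul, mul_one]
      generalize f A = a at this
      generalize f B = b at this
      revert a b
      decide
    · rw [Submodule.span_singleton_le_iff_mem, LinearMap.mem_ker]
      funext x
      exact CharTwo.add_self_eq_zero _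
  have hsurj : LinearMap.range δ = ⊤ := by
    rw [LinearMap.range_eq_top]
    choose S hS using fun x : N => hM.exists_cut hT hTG (rep x) (hrepT x) hF.some
    intro g
    refine ⟨∑ x, g x • fun A => if A ∈ S x then 1 else 0, ?_⟩
    rw [map_sum]
    have : ∀ x, δ (g x • fun A => if A ∈ S x then 1 else 0) = g x • Pi.single x 1 := by
      intro x
      rw [map_smul]
      congr 1
      funext y
      have h := (hS x).2 (rep y) (hrepT y)
      rw [hrep, hrep, ← Subtype.ext_iff] at h
      rw [hδ, Pi.single_apply, ← if_congr h rfl rfl]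
      by_cases h1 : M.face (rep y) ∈ S x <;> by_cases h2 : M.face (rep y).symm ∈ S x <;>
        simp [h1, h2, Xor]
      exact CharTwo.add_self_eq_zero _
    simp_rw [this]
    funext y
    simp only [Finset.sum_apply, Pi.smul_apply, Pi.single_apply, smul_eq_mul, mul_ite, mul_one,
      mul_zero]
    exact (Fintype.sum_eq_single y fun x hx => if_neg hx.symm).trans (if_pos rfl)
  have hrank := LinearMap.finrank_range_add_finrank_ker δ
  rw [hsurj, hker, finrank_top, finrank_span_singleton (by
    intro h
    exact one_ne_zero (congrFun h hF.some)), Module.finrank_pi, Module.finrank_pi,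
    Fintype.card_coe, Finset.card_sdiff_of_subset (edgeFinset_mono hTG)] at hrank
  have h1 := hT.card_edgeFinset
  have h2 := Finset.card_le_card (edgeFinset_mono hTG)
  rw [Nat.card_eq_fintype_card]
  omega

end RotationSystem

/-- Makes a power of `r` depend only on the dart reached, not on the number of turns chosen. -/
theorem Equiv.Perm.zpow_eq_zpow_of_apply_eq {α H : Type*} [Group H] (f : Equiv.Perm α) {a : α}
    {r : H} (hr : r ^ Function.minimalPeriod f a = 1) {i j : ℤ} (h : (f ^ i) a = (f ^ j) a) :
    r ^ i = r ^ j := by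
  have h1 : (f ^ (i - j)) • a = a := by
    rw [Equiv.Perm.smul_def, sub_eq_neg_add, zpow_add, Equiv.Perm.mul_apply, h,
      ← Equiv.Perm.mul_apply, ← zpow_add, neg_add_cancel, zpow_zero, Equiv.Perm.one_apply]
  obtain ⟨m, hm⟩ := MulAction.zpow_smul_eq_iff_minimalPeriod_dvd.mp h1
  have h2 : r ^ (i - j) = 1 := by
    rw [hm, zpow_mul, zpow_natCast]
    exact (congrArg (· ^ m) hr).trans (one_zpow m)
  rwa [zpow_sub, mul_inv_eq_one] at h2

/-! ### The developing map. -/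

namespace RotationSystem

open SimpleGraph

variable {V : Type*} {G T : SimpleGraph V} (M : RotationSystem G) {H : Type*} [Group H]

/-- Along a tree, the darts can be labelled by group elements so that turning around a vertex is
multiplication by `r` and reversing a dart of the tree is multiplication by `s`. -/
theorem exists_labelling_of_isTree {k : ℕ} (hT : T.IsTree)
    (hk : ∀ d, Function.minimalPeriod M.rot d = k) (hne : ∀ v, ∃ d : G.Dart, d.fst = v) {r s : H}
    (hr : r ^ k = 1) (hs : s * s = 1) : ∃ φ : G.Dart → H, (∀ d, φ (M.rot d) = r * φ d) ∧
      ∀ d : G.Dart, T.Adj d.fst d.snd → φ d.symm = s * φ d := by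
  classical
  choose b hb using hne
  choose j hj using fun d : G.Dart => M.sameCycle_of_fst_eq (b d.fst) d (hb d.fst)
  have hjrot : ∀ d, r ^ j (M.rot d) = r * r ^ j d := by
    intro d
    rw [← zpow_one_add]
    refine M.rot.zpow_eq_zpow_of_apply_eq (a := b d.fst) (by rw [hk, hr]) ?_
    rw [zpow_one_add, Equiv.Perm.mul_apply, hj d, ← M.rot_fst d, hj]
  have hsinv : s⁻¹ = s := inv_eq_of_mul_eq_one_left hs
  -- The factor forced by the reversal rule on the edge, for labels `r ^ j d * h d.fst`.
  let t : V → V → H := fun u v => if h : G.Adj u v then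
    (r ^ j (⟨(v, u), h.symm⟩ : G.Dart))⁻¹ * s * r ^ j (⟨(u, v), h⟩ : G.Dart) else 1
  obtain ⟨h, hh⟩ := hT.exists_potential t (fun u v => by
    by_cases huv : G.Adj u v
    · simp only [t, dif_pos huv, dif_pos huv.symm, mul_inv_rev, inv_inv, hsinv, mul_assoc]
    · simp only [t, dif_neg huv, dif_neg (fun h => huv (G.adj_symm h)), inv_one])
  refine ⟨fun d => r ^ j d * h d.fst, fun d => ?_, fun d hd => ?_⟩
  · simp only [hjrot, M.rot_fst, mul_assoc]
  · have h1 := hh _ _ hd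
    simp only [t, dif_pos d.adj] at h1
    change r ^ j d.symm * h d.snd = s * (r ^ j d * h d.fst)
    rw [h1]
    change r ^ j d.symm * ((r ^ j d.symm)⁻¹ * s * r ^ j d * h d.fst) = _
    group

section Labelling

variable {M} {φ : G.Dart → H} {r s : H}

/-- The last reversal around a face whose degree is a period of `r * s`. -/
theorem apply_symm_of_forall_ne [Finite V] (hrot : ∀ d, φ (M.rot d) = r * φ d) (e : G.Dart)
    (hrs : (r * s) ^ M.faceDegree (M.face e) = 1)
    (h : ∀ d, M.face d = M.face e → d ≠ e → φ d.symm = s * φ d) : φ e.symm = s * φ e := by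
  have : Finite G.Dart := finite_dart
  rw [faceDegree_face] at hrs
  set p := Function.minimalPeriod M.facePerm e with hp
  have hpos : 0 < p := Function.minimalPeriod_pos_of_mem_periodicPts
    (M.facePerm.injective.mem_periodicPts e)
  -- Reversal of `e` itself occurs only in the first step, and is left there as `φ e.symm`.
  have key : ∀ i, i + 1 ≤ p → φ (M.facePerm^[i + 1] e) = (r * s) ^ i * (r * φ e.symm) := by
    intro i
    induction i with
    | zero => intro; simp [facePerm_apply, hrot]
    | succ i ih =>
      intro hi
      rw [Function.iterate_succ_apply', facePerm_apply, hrot, h _ (M.face_iterate e _), ih (by omega)]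
      · rw [pow_succ']
        simp only [mul_assoc]
      · exact Function.not_isPeriodicPt_of_pos_of_lt_minimalPeriod (by omega) (by omega)
  have hlast := key (p - 1) (by omega)
  rw [Nat.sub_add_cancel hpos, Function.iterate_minimalPeriod] at hlast
  have h1 : r * s * φ e = r * φ e.symm := by
    rw [hlast, ← mul_assoc, ← pow_succ', Nat.sub_add_cancel hpos, hrs, one_mul]
  rw [mul_assoc] at h1
  exact (mul_left_cancel h1).symm

end Labelling

variable {M}

/-- The developing map: the darts of a planar drawing with one exceptional face can be labelled
compatibly with rotation and reversal. -/
theorem IsPlanar.exists_labelling [Fintype V] (hM : M.IsPlanar) (hG : G.Connected) {k n : ℕ}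
    (hk : ∀ d, Function.minimalPeriod M.rot d = k) (hne : ∀ v, ∃ d : G.Dart, d.fst = v)
    (F : M.Face) (hF : ∀ A, A ≠ F → M.faceDegree A = n) {r s : H} (hr : r ^ k = 1)
    (hs : s * s = 1) (hrs : (r * s) ^ n = 1) : ∃ φ : G.Dart → H,
      (∀ d, φ (M.rot d) = r * φ d) ∧ ∀ d : G.Dart, φ d.symm = s * φ d := by
  obtain ⟨T, hTG, hT⟩ := hG.exists_isTree_le
  obtain ⟨φ, hrot, hφT⟩ := M.exists_labelling_of_isTree hT hk hne hr hs
  refine ⟨φ, hrot, ?_⟩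
  have hsymm : ∀ d : G.Dart, φ d = s * φ d.symm → φ d.symm = s * φ d := by
    intro d h
    rw [h, ← mul_assoc, hs, one_mul]
  have : Finite M.Face := M.finite_face
  -- `S` is the part of the dual tree that `e` cuts off from `F`; induction on its size starts at
  -- the leaves.
  have key : ∀ (m : ℕ) (S : Set M.Face) (e : G.Dart), S.ncard = m → F ∉ S →
      (∀ d : G.Dart, ¬ T.Adj d.fst d.snd →
        (Xor (M.face d ∈ S) (M.face d.symm ∈ S) ↔ d.edge = e.edge)) →
      ¬ T.Adj e.fst e.snd → M.face e ∈ S → φ e.symm = s * φ e := by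
    intro m
    induction m using Nat.strong_induction_on with | _ m ih
    intro S e hSm hFS hS he heS
    have he' : M.face e.symm ∉ S := by
      have := (hS e he).mpr rfl
      simp only [Xor, heS] at this
      tauto
    refine apply_symm_of_forall_ne hrot e (by rw [hF _ (fun h => hFS (h ▸ heS)), hrs]) ?_
    intro d hde hne
    by_cases hdT : T.Adj d.fst d.snd
    · exact hφT d hdT
    have hdS : M.face d ∈ S := hde ▸ heS
    have hedge : d.edge ≠ e.edge := by
      intro h
      rcases (dart_edge_eq_iff _ _).mp h with h | h
      · exact hne h
      · exact he' (h ▸ hdS)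
    have hiff : ∀ (S' : Set M.Face) (x : G.Dart),
        ¬ Xor (M.face x ∈ S') (M.face x.symm ∈ S') ↔
          (M.face x ∈ S' ↔ M.face x.symm ∈ S') := fun _ _ => not_xor _ _
    have hdS' : M.face d.symm ∈ S :=
      ((hiff S d).mp (fun h => hedge ((hS d hdT).mp h))).mp hdS
    obtain ⟨S', hFS', hS'⟩ := hM.exists_cut hT hTG d hdT F
    have heq : M.face e ∈ S' ↔ M.face e.symm ∈ S' :=
      (hiff S' e).mp (fun h => hedge ((hS' e he).mp h).symm)
    have hcross : ∀ x : G.Dart, ¬ T.Adj x.fst x.snd →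
        (((M.face x ∈ S ↔ M.face x.symm ∈ S) ∧ (M.face x ∈ S' ↔ M.face x.symm ∈ S')) ∨
        x.edge = e.edge ∨ x.edge = d.edge) := by
      intro x hx
      rw [← hS x hx, ← hS' x hx, ← hiff, ← hiff]
      exact or_iff_not_imp_right.mpr fun h => not_or.mp h
    have hpair : ∀ x y : G.Dart, x.edge = y.edge → ∀ S'' : Set M.Face,
        (M.face y ∈ S'' ↔ M.face y.symm ∈ S'') → (M.face x ∈ S'' ↔ M.face x.symm ∈ S'') := by
      intro x y hxy S'' h
      rcases (dart_edge_eq_iff _ _).mp hxy with rfl | rfl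
      · exact h
      · rw [Dart.symm_symm]; exact h.symm
    -- Otherwise only tree edges would bound the set of faces outside both `S` and `S'`, which
    -- contains `F` but not the face of `e`.
    have heS' : M.face e ∉ S' := by
      intro h
      have := M.mem_iff_mem_of_isAcyclic hG hT.isAcyclic (Sᶜ ∩ S'ᶜ) (fun x hx => by
        rcases hcross x hx with ⟨h1, h2⟩ | h1 | h1
        · simp [h1, h2]
        · refine hpair x e h1 _ ?_
          simp [h, heq.mp h]
        · refine hpair x d h1 _ ?_
          simp [hdS, hdS']) F (M.face e)
      exact (this.mp ⟨hFS, hFS'⟩).1 heS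
    have hsub : S' ⊆ S := by
      intro A hA
      by_contra hAS
      have := M.mem_iff_mem_of_isAcyclic hG hT.isAcyclic (Sᶜ ∩ S') (fun x hx => by
        rcases hcross x hx with ⟨h1, h2⟩ | h1 | h1
        · simp [h1, h2]
        · refine hpair x e h1 _ ?_
          simp [heS', mt heq.mpr heS']
        · refine hpair x d h1 _ ?_
          simp [hdS, hdS']) A F
      exact hFS' (this.mp ⟨hAS, hA⟩).2
    have hlt : S'.ncard < m := hSm ▸ Set.ncard_lt_ncard ⟨hsub, fun h => heS' (h heS)⟩
    rcases (hS' d hdT).mpr rfl with h | h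
    · exact ih _ hlt S' d rfl hFS' hS' hdT h.1
    · refine hsymm d ?_
      have := ih _ hlt S' d.symm rfl hFS' (fun x hx => by rw [hS' x hx, Dart.edge_symm])
        (fun h => hdT h.symm) h.1
      rwa [Dart.symm_symm] at this
  intro e
  by_cases he : T.Adj e.fst e.snd
  · exact hφT e he
  obtain ⟨S, hFS, hS⟩ := hM.exists_cut hT hTG e he F
  rcases (hS e he).mpr rfl with h | h
  · exact key _ S e rfl hFS hS he h.1
  · refine hsymm e ?_
    have := key _ S e.symm rfl hFS (fun x hx => by rw [hS x hx, Dart.edge_symm])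
      (fun h => he h.symm) h.1
    rwa [Dart.symm_symm] at this

end RotationSystem

/-! ### Counting labelled darts. -/

namespace RotationSystem

open SimpleGraph

variable {V : Type*} {G : SimpleGraph V} {M : RotationSystem G}

/-- The number of darts, counted by faces. -/
theorem sum_faceDegree [Fintype V] [DecidableEq V] [DecidableRel G.Adj] [Fintype M.Face] :
    ∑ A, M.faceDegree A = 2 * G.edgeFinset.card := by
  classical
  rw [← G.dart_card_eq_twice_card_edges, ← Finset.card_univ,
    Finset.card_eq_sum_card_fiberwise (f := M.face) (t := Finset.univ) (by simp)]
  refine Finset.sum_congr rfl fun A _ => ?_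
  rw [faceDegree, Nat.card_eq_fintype_card, Fintype.card_subtype]

/-- In a simple graph of minimum degree at least 2, faces have degree at least 3. -/
theorem three_le_faceDegree [Finite V] (h : ∀ d, M.rot d ≠ d) (A : M.Face) :
    3 ≤ M.faceDegree A := by
  have : Finite G.Dart := finite_dart
  obtain ⟨d, rfl⟩ := M.exists_face_eq A
  rw [faceDegree_face]
  have hpos : 0 < Function.minimalPeriod M.facePerm d :=
    Function.minimalPeriod_pos_of_mem_periodicPts (M.facePerm.injective.mem_periodicPts d)
  have hper := Function.iterate_minimalPeriod (f := M.facePerm) (x := d)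
  have hfst : ∀ x, (M.facePerm x).fst = x.snd := fun x => M.rot_fst x.symm
  by_contra hlt
  have h12 : Function.minimalPeriod M.facePerm d = 1 ∨ Function.minimalPeriod M.facePerm d = 2 := by
    omega
  -- Length 1 would give a loop, and length 2 a fixed dart of `rot`.
  rcases h12 with h1 | h1 <;> rw [h1] at hper
  · have h2 := hfst d
    rw [show M.facePerm d = d from hper] at h2
    exact d.adj.ne h2
  · have h2 := hfst (M.facePerm d)
    rw [show M.facePerm (M.facePerm d) = d from hper] at h2
    refine h d.symm ?_
    change M.facePerm d = d.symm
    exact Dart.toProd_injective (Prod.ext (hfst d) h2.symm)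

/-- The fibres of an equivariant labelling of the darts by a group have the same size. -/
theorem card_dart_eq_card_mul_card_fiber [Finite V] {H : Type*} [Group H] [Finite H] {r s : H}
    (hcl : Subgroup.closure {r, s} = ⊤) {φ : G.Dart → H} (hrot : ∀ d, φ (M.rot d) = r * φ d)
    (hflip : ∀ d : G.Dart, φ d.symm = s * φ d) (x : H) :
    Nat.card G.Dart = Nat.card H * Nat.card {d // φ d = x} := by
  classical
  have : Finite G.Dart := finite_dart
  have := Fintype.ofFinite H
  -- Left translation by a generator is realised on darts by the bijection `rot` or `flip`.
  have hinv : ∀ h y, Nat.card {d // φ d = h * y} = Nat.card {d // φ d = y} := by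
    intro h
    have hh : h ∈ Subgroup.closure {r, s} := hcl ▸ Subgroup.mem_top h
    induction hh using Subgroup.closure_induction with
    | mem h hh =>
      intro y
      rcases hh with rfl | rfl
      · exact (Nat.card_congr (M.rot.subtypeEquiv fun d => by rw [hrot, mul_right_inj])).symm
      · exact (Nat.card_congr ((flip G).subtypeEquiv fun d => by
          rw [show flip G d = d.symm from rfl, hflip, mul_right_inj])).symm
    | one => simp
    | mul a b _ _ ha hb => intro y; rw [mul_assoc, ha, hb]
    | inv a _ ha => intro y; rw [← ha, mul_inv_cancel_left]
  rw [← Nat.card_congr (Equiv.sigmaFiberEquiv φ), Nat.card_sigma,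
    Finset.sum_congr rfl fun y _ => (by rw [← hinv (y * x⁻¹) x, inv_mul_cancel_right] :
      Nat.card {d // φ d = y} = Nat.card {d // φ d = x})]
  simp [Nat.card_eq_fintype_card]

/-- Around a face, an equivariant labelling takes each of its values several times. -/
theorem exists_faceDegree_eq_mul [Finite V] {H : Type*} [Group H] {r s : H}
    {φ : G.Dart → H} (hrot : ∀ d, φ (M.rot d) = r * φ d)
    (hflip : ∀ d : G.Dart, φ d.symm = s * φ d) (e : G.Dart) :
    ∃ m, M.faceDegree (M.face e) = m * orderOf (r * s) ∧ m ≤ Nat.card {d // φ d = φ e} := by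
  have : Finite G.Dart := finite_dart
  rw [faceDegree_face]
  have hit : ∀ i, φ (M.facePerm^[i] e) = (r * s) ^ i * φ e := by
    intro i
    induction i with
    | zero => simp
    | succ i ih =>
      rw [Function.iterate_succ_apply', facePerm_apply, hrot, hflip, ih, pow_succ']
      simp only [mul_assoc]
  have h1 := hit (Function.minimalPeriod M.facePerm e)
  rw [Function.iterate_minimalPeriod, right_eq_mul] at h1
  obtain ⟨m, hm⟩ := orderOf_dvd_of_pow_eq_one h1
  refine ⟨m, by rw [hm, mul_comm], ?_⟩
  have hpos : 0 < Function.minimalPeriod M.facePerm e :=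
    Function.minimalPeriod_pos_of_mem_periodicPts (M.facePerm.injective.mem_periodicPts e)
  have hn : 0 < orderOf (r * s) := Nat.pos_of_ne_zero fun h => by simp [hm, h] at hpos
  -- Every `orderOf (r * s)` steps along the face the label of `e` returns, at distinct darts within
  -- one period.
  let g : Fin m → {d // φ d = φ e} := fun i => ⟨M.facePerm^[orderOf (r * s) * i] e, by
    rw [hit, pow_mul, pow_orderOf_eq_one, one_pow, one_mul]⟩
  have hg : Function.Injective g := by
    intro i j hij
    have h2 : M.facePerm^[orderOf (r * s) * i] e = M.facePerm^[orderOf (r * s) * j] e :=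
      congrArg Subtype.val hij
    have h3 := Function.iterate_injOn_Iio_minimalPeriod
      (by rw [Set.mem_Iio, hm]; exact Nat.mul_lt_mul_of_pos_left i.2 hn)
      (by rw [Set.mem_Iio, hm]; exact Nat.mul_lt_mul_of_pos_left j.2 hn) h2
    exact Fin.ext (Nat.eq_of_mul_eq_mul_left hn h3)
  simpa using Nat.card_le_card_of_injective g hg

end RotationSystem

theorem theorem4 {V : Type*} [Fintype V] (G : SimpleGraph V) [DecidableRel G.Adj]
    (hconn : G.Connected) (k : ℕ) (hk : 3 ≤ k) (hreg : G.IsRegularOfDegree k)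
    (M : RotationSystem G) (hM : M.IsPlanar) :
    ¬ ∃ d₁ d₂ : ℕ, d₁ ≠ d₂ ∧
      ∃ F : M.Face, M.faceDegree F = d₁ ∧ ∀ F' : M.Face, F' ≠ F → M.faceDegree F' = d₂ := by
  classical
  rintro ⟨d₁, d₂, hne, F, hF₁, hF₂⟩
  have : Fintype M.Face := have := M.finite_face; Fintype.ofFinite _
  have hper : ∀ d, Function.minimalPeriod M.rot d = k := fun d =>
    (M.minimalPeriod_rot d).trans (hreg d.fst)
  have hdart : ∀ v, ∃ d : G.Dart, d.fst = v := by
    intro v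
    obtain ⟨w, hw⟩ := (G.degree_pos_iff_exists_adj v).mp (by rw [hreg v]; omega)
    exact ⟨⟨(v, w), hw⟩, rfl⟩
  have hdeg := RotationSystem.three_le_faceDegree (M := M) fun d hd => by
    have := hper d
    rw [Function.minimalPeriod_eq_one_iff_isFixedPt.mpr hd] at this
    omega
  have heuler := hM.card_face_add_card hconn ⟨F⟩
  have hvert : Fintype.card V * k = 2 * G.edgeFinset.card := by
    rw [← G.sum_degrees_eq_twice_card_edges, Finset.sum_congr rfl fun v _ => hreg v]
    simp
  have hsum := RotationSystem.sum_faceDegree (M := M)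
  rw [← Finset.add_sum_erase _ _ (Finset.mem_univ F), hF₁,
    Finset.sum_congr rfl fun A hA => hF₂ A (Finset.ne_of_mem_erase hA), Finset.sum_const,
    Finset.card_erase_of_mem (Finset.mem_univ F), Finset.card_univ, smul_eq_mul] at hsum
  have hface : 1 ≤ Fintype.card M.Face := Fintype.card_pos_iff.mpr ⟨F⟩
  rw [Nat.card_eq_fintype_card] at heuler
  obtain ⟨f, hf⟩ := Nat.exists_eq_add_of_le' hface
  rw [hf, Nat.add_sub_cancel] at hsum
  rw [hf] at heuler
  have hd₁ : 3 ≤ d₁ := hF₁ ▸ hdeg F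
  -- With `F` alone, Euler's formula leaves one edge fewer than vertices, too few for `k ≥ 3`.
  have hfpos : 0 < f := by
    rcases Nat.eq_zero_or_pos f with h | h
    · subst h
      nlinarith
    · exact h
  have hd₂ : 3 ≤ d₂ := by
    have : Nontrivial M.Face := Fintype.one_lt_card_iff_nontrivial.mp (by omega)
    obtain ⟨A, hA⟩ := exists_ne F
    exact hF₂ A hA ▸ hdeg A
  -- Euler's formula times `2 * k * d₂`, with vertices and faces eliminated by the dart counts.
  have hE : 2 * G.edgeFinset.card * (2 * d₂ + 2 * k) =
      2 * k * (d₁ + d₂) + 2 * G.edgeFinset.card * (k * d₂) := by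
    zify at heuler hvert hsum ⊢
    linear_combination 2 * k * d₂ * heuler - 2 * d₂ * hvert - 2 * k * hsum
  have hsph : k * d₂ < 2 * d₂ + 2 * k := by
    by_contra h
    have := Nat.mul_le_mul_left (2 * G.edgeFinset.card) (not_lt.mp h)
    have : 0 < 2 * k * (d₁ + d₂) := by positivity
    omega
  obtain ⟨H, _, _, r, s, hr, hs, hrs, hcl, hcard⟩ := HasRotationGroup.of_spherical hk hd₂ hsph
  obtain ⟨φ, hrot, hflip⟩ := hM.exists_labelling hconn hper hdart F hF₂
    (by rw [← hr, pow_orderOf_eq_one]) hs (by rw [← hrs, pow_orderOf_eq_one] : (r * s) ^ d₂ = 1)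
  obtain ⟨e, rfl⟩ := M.exists_face_eq F
  obtain ⟨m, hm, hmn⟩ := RotationSystem.exists_faceDegree_eq_mul hrot hflip e
  have hD := RotationSystem.card_dart_eq_card_mul_card_fiber hcl hrot hflip (φ e)
  rw [hF₁, hrs] at hm
  rw [Nat.card_eq_fintype_card, G.dart_card_eq_twice_card_edges] at hD
  set n := Nat.card {d // φ d = φ e}
  have h1 : n * (4 * k * d₂) ≤ 2 * k * (m * d₂ + d₂) := by
    rw [hD, hm] at hE
    have := Nat.mul_le_mul_left n hcard
    nlinarith
  have h2 : 2 * n ≤ m + 1 := by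
    have : (2 * k * d₂) * (2 * n) ≤ (2 * k * d₂) * (m + 1) := by linarith
    exact Nat.le_of_mul_le_mul_left this (by positivity)
  -- From `2 * n ≤ m + 1` and `m ≤ n`.
  have hm1 : m = 0 ∨ m = 1 := by omega
  rcases hm1 with rfl | rfl <;> omega
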